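/- Let ${\bf k}$ be an algebraically closed field, $\Sigma$ a smooth fan in a lattice $N$ with dual lattice $M$, with rays $\varrho_1,\dots,\varrho_n$ and primitive ray generators $\rho_1,\dots,\rho_n$. Let $\mathcal E$ be a toric vector bundle on the toric variety $Y(\Sigma)$, given by its prevaluation $\mathfrak v$ on the fibre $E$ with values in the integral piecewise linear functions on $|\Sigma|\cap N$ (on each cone $\sigma\in\Sigma$ there are a basis $(e_a)$ of $E$ and $m_a\in M$ with $\mathfrak v(\sum c_ae_a)(\rho)=\min\{\langle \rho,m_a\rangle : c_a\neq 0\}$ for all $\rho\in\sigma\cap N$), and extend $\mathfrak v$ to $\operatorname{Sym}(E)$ in the natural way: $\mathfrak v(f)(\rho)\ge r$ if and only if $f$ is a sum of products $e_1\cdots e_m$ of vectors of $E$ with $\sum_i\mathfrak v(e_i)(\rho)\ge r$. Let $d\ge 1$ and let $\mathcal B=\{b_1,\dots,b_d\}\subset E\subset\operatorname{Sym}(E)$ be a Khovanskii basis of $\mathfrak v$ (that is, $\mathcal B$ generates $\operatorname{Sym}(E)$ and, for each $\rho\in|\Sigma|\cap N$, its classes generate the associated graded algebra of $\mathfrak v(\cdot)(\rho)$),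 such that the kernel of ${\bf k}[y_1,\dots,y_d]\to\operatorname{Sym}(E)$, $y_j\mapsto b_j$, is $\langle\sum_{j=1}^d y_j\rangle$. Let $D$ be the diagram of $\mathcal E$, i.e. the $n\times d$ matrix with entries $D_{ij}=\mathfrak v(b_j)(\rho_i)$, and suppose that its rows $w_1,\dots,w_n$ lie in $\operatorname{Trop}(\sum_{j=1}^d y_j)$. For $\psi\in\mathbb Z^n$, regarded as the integral piecewise linear function on $\Sigma$ with $\psi(\rho_i)=\psi_i$, let $F_\psi=\{f\in\operatorname{Sym}(E) : \mathfrak v(f)\ge\psi \text{ on } |\Sigma|\cap N\}$, and let $\mathcal R(\mathcal E)=\bigoplus_{\psi\in\mathbb Z^n}F_\psi t^\psi\subset\operatorname{Sym}(E)\otimes_{\bf k}{\bf k}[t_1^{\pm1},\dots,t_n^{\pm1}]$ be the ring of global sections, an algebra over the Cox ring ${\bf k}[X_1,\dots,X_n]$ of $Y(\Sigma)$ through $X_i\mapsto t_i^{-1}$. The set $\mathcal B$ is called a strong Khovanskii basis if it is the image, under the quotient map $t_1=\dots=t_n=1$ onto $\operatorname{Sym}(E)$, of a set of $\mathbb Z^n$-homogeneous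 generators of $\mathcal R(\mathcal E)$ as a ${\bf k}[X_1,\dots,X_n]$-algebra. Then $\mathcal B$ is a strong Khovanskii basis if and only if for each pair of rows $w_i,w_{i'}$ of $D$ there is a column that contains a minimal entry of $w_i$ and a minimal entry of $w_{i'}$, that is, there is $j$ with $D_{ij}=\min_l D_{il}$ and $D_{i'j}=\min_l D_{i'l}$. -/

import Mathlib

open scoped BigOperators

/-- A smooth fan in the lattice `N`, with rays indexed by `ι`. A cone is recorded by the set of
its rays; its primitive ray generators are part of a `ℤ`-basis of `N`. -/
structure SmoothFan (N ι : Type*) [AddCommGroup N] [Fintype ι] [DecidableEq ι] where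
  /-- the primitive generator of each ray -/
  gen : ι → N
  cones : Set (Finset ι)
  empty_mem : ∅ ∈ cones
  ray_mem : ∀ i, {i} ∈ cones
  face_mem : ∀ σ ∈ cones, ∀ τ, τ ⊆ σ → τ ∈ cones
  smooth : ∀ σ ∈ cones, ∃ (r : ℕ) (e : Module.Basis (Fin r) ℤ N) (g : σ ↪ Fin r),
    ∀ i : σ, gen i = e (g i)
  /-- Two cones meet in the cone over their common rays (stated on lattice points, which
  determine a rational cone). -/
  inter : ∀ σ ∈ cones, ∀ τ ∈ cones, ∀ x : N,
    (∃ c : ι → ℕ, x = ∑ i ∈ σ, c i • gen i) → (∃ c : ι → ℕ, x = ∑ i ∈ τ, c i • gen i) →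
      ∃ c : ι → ℕ, x = ∑ i ∈ σ ∩ τ, c i • gen i

namespace SmoothFan

variable {N ι : Type*} [AddCommGroup N] [Fintype ι] [DecidableEq ι]

/-- The lattice points of the cone `σ` (all of them, by smoothness). -/
def coneN (F : SmoothFan N ι) (σ : Finset ι) : Set N :=
  {x | ∃ c : ι → ℕ, x = ∑ i ∈ σ, c i • F.gen i}

/-- The lattice points of the support `|Σ|`. -/
def support (F : SmoothFan N ι) : Set N :=
  {x | ∃ σ ∈ F.cones, x ∈ F.coneN σ}

theorem gen_mem_support (F : SmoothFan N ι) (i : ι) : F.gen i ∈ F.support :=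
  ⟨{i}, F.ray_mem i, fun _ => 1, by simp⟩

/-- The primitive ray generator `ρ i`, as a point of `|Σ| ∩ N`. -/
def ray (F : SmoothFan N ι) (i : ι) : F.support := ⟨F.gen i, F.gen_mem_support i⟩

/-- `F.IsPLValue ψ ρ r` says that `r` is the value at `ρ` of the piecewise linear function on the
fan whose values at the ray generators are `ψ`. As the fan is smooth, the tuples `ψ : ι → ℤ` are
exactly the integral piecewise linear functions on the fan, that is, the torus-linearized line
bundles on the toric variety. -/
def IsPLValue (F : SmoothFan N ι) (ψ : ι → ℤ) (ρ : F.support) (r : ℤ) : Prop :=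
  ∃ σ ∈ F.cones, ∃ c : ι → ℕ, (ρ : N) = ∑ i ∈ σ, c i • F.gen i ∧ r = ∑ i ∈ σ, (c i : ℤ) * ψ i

end SmoothFan

/-- A toric vector bundle on the toric variety of the fan `F`, with fibre `E` over the identity of
the torus, given by its prevaluation `E → 𝓞_Σ` into piecewise linear functions: on each cone `σ`
there is a basis of `E` and there are integral linear functions `m a` such that a vector has at
`ρ ∈ σ` the minimum of the `m a ρ` over the basis vectors that occur in it (a linear adapted
basis). -/
structure ToricVectorBundle (k : Type*) {N ι : Type*} [Field k] [AddCommGroup N] [Fintype ι]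
    [DecidableEq ι] (F : SmoothFan N ι) (E : Type*) [AddCommGroup E] [Module k E] where
  val : E → F.support → WithTop ℤ
  exists_adapted : ∀ σ ∈ F.cones, ∃ (r : ℕ) (e : Module.Basis (Fin r) k E) (m : Fin r → N →+ ℤ),
    ∀ (f : E) (ρ : F.support), (ρ : N) ∈ F.coneN σ →
      val f ρ = (e.repr f).support.inf fun a => ((m a (ρ : N) : ℤ) : WithTop ℤ)

/-- `B` is a Khovanskii basis for a decreasing multiplicative filtration `G` of `A`: the classes of
the elements of `B` generate the associated graded algebra `⨁ r, G r / G (r + 1)`. That is, modulo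
`G (r + 1)`, every element of `G r` is a combination of products of elements `b ∈ B`, each taken
in a degree `s` with `b ∈ G s` (it gives `0` unless `s` is the exact value of `b`), of total
degree `r`. -/
def IsKhovanskiiBasisFor {k A : Type*} [Field k] [CommRing A] [Algebra k A]
    (G : ℤ → Submodule k A) (B : Set A) : Prop :=
  ∀ r : ℤ, G r ≤ Submodule.span k {p : A | ∃ l : List (A × ℤ),
    (∀ x ∈ l, x.1 ∈ B ∧ x.1 ∈ G x.2) ∧ (l.map Prod.snd).sum = r ∧ p = (l.map Prod.fst).prod} ⊔
      G (r + 1)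

namespace ToricVectorBundle

variable {k N ι E : Type*} [Field k] [AddCommGroup N] [Fintype ι] [DecidableEq ι]
  [AddCommGroup E] [Module k E] {F : SmoothFan N ι}

/-- The filtration `{f | v(f)(ρ) ≥ r}` at `ρ` of the induced valuation `v` on `Sym E`: it is
spanned by the products of vectors of `E` whose values add up to at least `r`. -/
def filt (V : ToricVectorBundle k F E) (ρ : F.support) (r : ℤ) :
    Submodule k (SymmetricAlgebra k E) :=
  Submodule.span k {p | ∃ l : List E, (r : WithTop ℤ) ≤ (l.map fun e => V.val e ρ).sum ∧
    p = (l.map (SymmetricAlgebra.ι k E)).prod}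

/-- The Klyachko space `F_ψ = {f ∈ Sym E | v(f) ≥ ψ on |Σ|}`. -/
def klyachko (V : ToricVectorBundle k F E) (ψ : ι → ℤ) : Submodule k (SymmetricAlgebra k E) :=
  ⨅ (ρ : F.support) (r : ℤ) (_ : F.IsPLValue ψ ρ r), V.filt ρ r

theorem filt_mul_mem (V : ToricVectorBundle k F E) (ρ : F.support) {r s : ℤ}
    {x y : SymmetricAlgebra k E} (hx : x ∈ V.filt ρ r) (hy : y ∈ V.filt ρ s) :
    x * y ∈ V.filt ρ (r + s) := by
  have h : V.filt ρ r * V.filt ρ s ≤ V.filt ρ (r + s) := by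
    unfold filt
    rw [Submodule.span_mul_span]
    apply Submodule.span_mono
    rintro _ ⟨_, ⟨l, hl, rfl⟩, _, ⟨l', hl', rfl⟩, rfl⟩
    refine ⟨l ++ l', ?_, by simp⟩
    simp only [List.map_append, List.sum_append, WithTop.coe_add]
    exact add_le_add hl hl'
  exact h (Submodule.mul_mem_mul hx hy)

theorem klyachko_mul_mem (V : ToricVectorBundle k F E) {ψ φ : ι → ℤ}
    {x y : SymmetricAlgebra k E} (hx : x ∈ V.klyachko ψ) (hy : y ∈ V.klyachko φ) :
    x * y ∈ V.klyachko (ψ + φ) := by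
  simp only [klyachko, Submodule.mem_iInf] at hx hy ⊢
  rintro ρ _ ⟨σ, hσ, c, hc, rfl⟩
  have := V.filt_mul_mem ρ (hx ρ _ ⟨σ, hσ, c, hc, rfl⟩) (hy ρ _ ⟨σ, hσ, c, hc, rfl⟩)
  simpa [mul_add, Finset.sum_add_distrib] using this

theorem one_mem_klyachko (V : ToricVectorBundle k F E) :
    (1 : SymmetricAlgebra k E) ∈ V.klyachko 0 := by
  simp only [klyachko, Submodule.mem_iInf]
  rintro ρ _ ⟨σ, hσ, c, hc, rfl⟩
  exact Submodule.subset_span ⟨[], by simp, by simp⟩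

/-- The ring of global sections `⨁ ψ, F_ψ` of `Sym` of the bundle (the Cox ring of the
projectivized bundle), as a subring of the Laurent polynomials over `Sym E` in one variable
for each ray. -/
def sectionRing (V : ToricVectorBundle k F E) :
    Subalgebra k (AddMonoidAlgebra (SymmetricAlgebra k E) (ι → ℤ)) where
  carrier := {x | ∀ ψ, x.coeff ψ ∈ V.klyachko ψ}
  add_mem' := fun hx hy ψ => add_mem (hx ψ) (hy ψ)
  mul_mem' := by
    classical
    intro x y hx hy ψ
    rw [AddMonoidAlgebra.coeff_mul]
    refine sum_mem fun a _ => sum_mem fun b _ => ?_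
    dsimp only
    split_ifs with h
    · exact h ▸ V.klyachko_mul_mem (hx a) (hy b)
    · exact zero_mem _
  algebraMap_mem' := by
    classical
    intro c ψ
    have : (algebraMap k (AddMonoidAlgebra (SymmetricAlgebra k E) (ι → ℤ)) c) =
        AddMonoidAlgebra.single 0 (algebraMap k (SymmetricAlgebra k E) c) := rfl
    rw [this, AddMonoidAlgebra.coeff_single, Finsupp.single_apply]
    split_ifs with h
    · rw [← h, Algebra.algebraMap_eq_smul_one]
      exact Submodule.smul_mem _ _ V.one_mem_klyachko
    · exact zero_mem _

/-- The variable `X i = 1 ⊗ t_i⁻¹` of the Cox ring of the toric variety. -/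
noncomputable def coxVar (k E : Type*) {ι : Type*} [Field k] [DecidableEq ι] [AddCommGroup E] [Module k E]
    (i : ι) : AddMonoidAlgebra (SymmetricAlgebra k E) (ι → ℤ) :=
  AddMonoidAlgebra.single (-(Pi.single i 1)) 1

/-- The quotient map that sets every Laurent variable to `1`. -/
noncomputable def specialize (k E ι : Type*) [Field k] [AddCommGroup E] [Module k E] :
    AddMonoidAlgebra (SymmetricAlgebra k E) (ι → ℤ) →ₐ[SymmetricAlgebra k E]
      SymmetricAlgebra k E :=
  AddMonoidAlgebra.lift (SymmetricAlgebra k E) (SymmetricAlgebra k E) (ι → ℤ) 1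

/-- `B ⊆ Sym E` is a Khovanskii basis: it generates `Sym E`, and its classes generate the
associated graded algebra of the valuation at every `ρ ∈ |Σ| ∩ N`. -/
def IsKhovanskiiBasis (V : ToricVectorBundle k F E) (B : Set (SymmetricAlgebra k E)) : Prop :=
  Algebra.adjoin k B = ⊤ ∧ ∀ ρ : F.support, IsKhovanskiiBasisFor (V.filt ρ) B

/-- `B ⊆ Sym E` is a strong Khovanskii basis: it is the image of a set of homogeneous elements
that generates the section ring as an algebra over the Cox ring `k[X i]` of the toric variety. -/
def IsStrongKhovanskiiBasis (V : ToricVectorBundle k F E) (B : Set (SymmetricAlgebra k E)) :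
    Prop :=
  ∃ S : Set (AddMonoidAlgebra (SymmetricAlgebra k E) (ι → ℤ)),
    (∀ s ∈ S, ∃ ψ a, s = AddMonoidAlgebra.single ψ a) ∧
    Algebra.adjoin k (Set.range (coxVar k E (ι := ι)) ∪ S) = V.sectionRing ∧
    specialize k E ι '' S = B

/-- The diagram of the bundle with respect to the vectors `b j`: the row of the ray `i` consists
of the values of the `b j` at its primitive generator. -/
def diagram (V : ToricVectorBundle k F E) {d : ℕ} (b : Fin d → E) :
    Matrix ι (Fin d) (WithTop ℤ) :=
  fun i j => V.val (b j) (F.ray i)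

end ToricVectorBundle

/-- The tropical hypersurface of `p` over `ℤ ∪ {∞}`: leaving out any one term of `p` does not change
the minimum of the weights of the terms. -/
def tropicalHypersurface {k : Type*} [Field k] {d : ℕ} (p : MvPolynomial (Fin d) k) :
    Set (Fin d → WithTop ℤ) :=
  {w | ∀ α ∈ p.support, (p.support.inf fun β => ∑ j, β j • w j) =
    (p.support.erase α).inf fun β => ∑ j, β j • w j}

/-! Put `s = ∑ y_j`, so that `Sym E = k[y]/(s)`. The Khovanskii property at the ray `i` says that
every element of the `r`-th filtration step lifts to a polynomial whose monomials all have
`w_i`-weight at least `r` (`filt_le_map_weightGE`). An element of `F_ψ` therefore has one lift for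
each ray, and being a strong Khovanskii basis amounts to having one lift that works for all rays at
once.

If any two rows have a common minimal column, the separate lifts can be merged
(`exists_mem_weightGE_of_forall`): start from a low bound `φ` and raise one coordinate by one at a
time. To raise `φ i`, the `i`-initial form of the current lift, which is `in_i(s) * h₀`, is removed
by subtracting `s * h₀`. This keeps the other bounds because the common column gives `in_i(s)` the
same `i'`-order as `s`; cancelling it in the domain `k[y]` bounds the `i'`-weights of `h₀`.

Conversely, suppose rows `i`, `i'` have no common minimal column, and let `M` be the set of minimal
columns of row `i`. Then `∑_{M} b_j = -∑_{Mᶜ} b_j` exceeds the row minimum at both rays, the first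
sum showing it at `i'` and the second at `i`. Any lift is `∑_{M} y_j + s * a`, and removing the
forbidden linear terms would require `a(0) = -1` and `a(0) = 0`. -/

/-! ### Weight filtrations and initial forms in a polynomial ring. -/

namespace MvPolynomial

variable {k σ : Type*} [Field k]

/-- The polynomials all of whose monomials have weight at least `r`. -/
def weightGE (k : Type*) {σ : Type*} [Field k] (w : σ → ℤ) (r : ℤ) :
    Submodule k (MvPolynomial σ k) where
  carrier := {p | ∀ α, coeff α p ≠ 0 → r ≤ Finsupp.weight w α}
  add_mem' := by
    intro p q hp hq α hα
    by_contra h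
    apply hα
    rw [coeff_add, not_not.1 (mt (hp α) h), not_not.1 (mt (hq α) h), add_zero]
  zero_mem' := by intro α hα; simp at hα
  smul_mem' := by
    intro a p hp α hα
    refine hp α fun h => hα ?_
    rw [coeff_smul, h, smul_zero]

theorem mem_weightGE {w : σ → ℤ} {r : ℤ} {p : MvPolynomial σ k} :
    p ∈ weightGE k w r ↔ ∀ α, coeff α p ≠ 0 → r ≤ Finsupp.weight w α := Iff.rfl

theorem weightGE_anti (w : σ → ℤ) {r s : ℤ} (h : r ≤ s) : weightGE k w s ≤ weightGE k w r :=
  fun _ hp α hα => h.trans (hp α hα)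

theorem X_mem_weightGE {w : σ → ℤ} {r : ℤ} {j : σ} (h : r ≤ w j) :
    (X j : MvPolynomial σ k) ∈ weightGE k w r := by
  classical
  intro α hα
  rw [coeff_X] at hα
  split_ifs at hα with h'
  · subst h'; simpa [Finsupp.weight_single] using h
  · exact absurd rfl hα

theorem one_mem_weightGE {w : σ → ℤ} {r : ℤ} (h : r ≤ 0) :
    (1 : MvPolynomial σ k) ∈ weightGE k w r := by
  classical
  intro α hα
  rw [coeff_one] at hα
  split_ifs at hα with h'
  · subst h'; simpa using h
  · exact absurd rfl hα

theorem mul_mem_weightGE {w : σ → ℤ} {r s : ℤ} {p q : MvPolynomial σ k}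
    (hp : p ∈ weightGE k w r) (hq : q ∈ weightGE k w s) : p * q ∈ weightGE k w (r + s) := by
  classical
  intro α hα
  rw [coeff_mul] at hα
  obtain ⟨⟨β, γ⟩, hβγ, h⟩ := Finset.exists_ne_zero_of_sum_ne_zero hα
  rw [← Finset.HasAntidiagonal.mem_antidiagonal.1 hβγ, map_add]
  exact add_le_add (hp β (left_ne_zero_of_mul h)) (hq γ (right_ne_zero_of_mul h))

theorem weightedHomogeneousComponent_mem_weightGE {w w' : σ → ℤ} {r : ℤ}
    {p : MvPolynomial σ k} (hp : p ∈ weightGE k w r) (m : ℤ) :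
    weightedHomogeneousComponent w' m p ∈ weightGE k w r := by
  classical
  intro α hα
  rw [coeff_weightedHomogeneousComponent] at hα
  exact hp α fun h => hα (by simp [h])

theorem weightedHomogeneousComponent_mem_weightGE_self (w : σ → ℤ) (m : ℤ)
    (p : MvPolynomial σ k) : weightedHomogeneousComponent w m p ∈ weightGE k w m :=
  fun _ hα => (weightedHomogeneousComponent_isWeightedHomogeneous m p hα).ge

theorem sub_weightedHomogeneousComponent_mem {w : σ → ℤ} {r : ℤ} {p : MvPolynomial σ k}
    (hp : p ∈ weightGE k w r) :
    p - weightedHomogeneousComponent w r p ∈ weightGE k w (r + 1) := by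
  classical
  intro α hα
  rw [coeff_sub, coeff_weightedHomogeneousComponent] at hα
  split_ifs at hα with h
  · simp at hα
  · exact lt_of_le_of_ne (hp α (by simpa using hα)) (Ne.symm h)

theorem weightedHomogeneousComponent_eq_zero_of_mem {w : σ → ℤ} {r m : ℤ}
    {p : MvPolynomial σ k} (hp : p ∈ weightGE k w r) (hm : m < r) :
    weightedHomogeneousComponent w m p = 0 := by
  classical
  ext α
  rw [coeff_weightedHomogeneousComponent, coeff_zero]
  split_ifs with h
  · by_contra h'
    have := hp α h'
    omega
  · rfl

/-- Initial forms multiply: every term of `p * q` outside the product of the lowest parts has weight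
at least `a + b + 1`. -/
theorem weightedHomogeneousComponent_mul {w : σ → ℤ} {a b : ℤ} {p q : MvPolynomial σ k}
    (hp : p ∈ weightGE k w a) (hq : q ∈ weightGE k w b) :
    weightedHomogeneousComponent w (a + b) (p * q) =
      weightedHomogeneousComponent w a p * weightedHomogeneousComponent w b q := by
  set p₀ := weightedHomogeneousComponent w a p with hp₀
  set q₀ := weightedHomogeneousComponent w b q with hq₀
  have h : p * q = p₀ * q₀ + ((p - p₀) * q + p₀ * (q - q₀)) := by ring
  have h1 : (p - p₀) * q ∈ weightGE k w (a + b + 1) := by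
    have := mul_mem_weightGE (sub_weightedHomogeneousComponent_mem hp) hq
    rwa [add_right_comm] at this
  have h2 : p₀ * (q - q₀) ∈ weightGE k w (a + b + 1) := by
    have := mul_mem_weightGE (weightedHomogeneousComponent_mem_weightGE_self w a p)
      (sub_weightedHomogeneousComponent_mem hq)
    rwa [← add_assoc] at this
  rw [h, map_add, weightedHomogeneousComponent_eq_zero_of_mem (add_mem h1 h2) (by omega),
    add_zero]
  exact ((weightedHomogeneousComponent_isWeightedHomogeneous a p).mul
    (weightedHomogeneousComponent_isWeightedHomogeneous b q)).weightedHomogeneousComponent_same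

/-- The weight order is additive on products, so that a factor of known order can be cancelled. -/
theorem mem_weightGE_of_mul_mem {w : σ → ℤ} {a b : ℤ} {p q : MvPolynomial σ k}
    (hp : p ∈ weightGE k w a) (hp₀ : weightedHomogeneousComponent w a p ≠ 0)
    (h : p * q ∈ weightGE k w (a + b)) : q ∈ weightGE k w b := by
  classical
  by_cases hq : q = 0
  · rw [hq]; exact zero_mem _
  obtain ⟨α, hα, hmin⟩ := q.support.exists_min_image (Finsupp.weight w)
    (by simpa [Finset.nonempty_iff_ne_empty] using hq)
  have hqm : q ∈ weightGE k w (Finsupp.weight w α) :=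
    fun β hβ => hmin β (mem_support_iff.2 hβ)
  have hq₀ : weightedHomogeneousComponent w (Finsupp.weight w α) q ≠ 0 := by
    intro h0
    have := congrArg (coeff α) h0
    rw [coeff_weightedHomogeneousComponent, if_pos rfl] at this
    exact mem_support_iff.1 hα (by simpa using this)
  refine weightGE_anti w ?_ hqm
  by_contra hlt
  have := weightedHomogeneousComponent_mul hp hqm
  rw [weightedHomogeneousComponent_eq_zero_of_mem h (by omega)] at this
  exact mul_ne_zero hp₀ hq₀ this.symm

/-! ### Merging lifts modulo the sum of the variables. -/

section SumX

variable [Fintype σ]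

theorem coeff_weightedHomogeneousComponent_sum_X (w : σ → ℤ) (c : ℤ) (j : σ) :
    coeff (Finsupp.single j 1) (weightedHomogeneousComponent w c
      (∑ l, X l : MvPolynomial σ k)) = if w j = c then 1 else 0 := by
  classical
  rw [coeff_weightedHomogeneousComponent, Finsupp.weight_single, one_smul, coeff_sum]
  simp [coeff_X, Finsupp.single_left_inj]

theorem sum_X_mem_weightGE {w : σ → ℤ} {c : ℤ} (hc : ∀ j, c ≤ w j) :
    (∑ l, X l : MvPolynomial σ k) ∈ weightGE k w c :=
  sum_mem fun j _ => X_mem_weightGE (hc j)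

variable {ι : Type*} [DecidableEq ι]

/-- If a polynomial of weights at least `φ` has `i`-weight at least `φ i + 1` modulo the sum of the
variables, then modulo that sum it has weights at least `φ + e_i`. -/
theorem exists_sub_sum_X_mul_mem_weightGE {w : ι → σ → ℤ} {c : ι → ℤ} (hc : ∀ i j, c i ≤ w i j)
    (hpair : ∀ i i', ∃ j, w i j = c i ∧ w i' j = c i') {φ : ι → ℤ} {i : ι}
    {g h : MvPolynomial σ k} (hg : ∀ i, g ∈ weightGE k (w i) (φ i))
    (hgh : g - (∑ l, X l) * h ∈ weightGE k (w i) (φ i + 1)) :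
    ∃ h₀, ∀ i', g - (∑ l, X l) * h₀ ∈
      weightGE k (w i') (φ i' + (Pi.single i 1 : ι → ℤ) i') := by
  set s : MvPolynomial σ k := ∑ l, X l with hs
  have hsc : ∀ i, s ∈ weightGE k (w i) (c i) := fun i => sum_X_mem_weightGE (hc i)
  -- The variable of a column minimal in both rows survives in the `i'`-initial form of the
  -- `i`-initial form of `s`.
  have hs0 : ∀ i', weightedHomogeneousComponent (w i') (c i')
      (weightedHomogeneousComponent (w i) (c i) s) ≠ 0 := by
    classical
    intro i' h0
    obtain ⟨j, hj, hj'⟩ := hpair i i'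
    have := congrArg (coeff (Finsupp.single j 1)) h0
    rw [coeff_weightedHomogeneousComponent, Finsupp.weight_single, one_smul, if_pos hj',
      coeff_weightedHomogeneousComponent_sum_X, if_pos hj] at this
    simp at this
  have hs1 : weightedHomogeneousComponent (w i) (c i) s ≠ 0 := by
    intro h0
    apply hs0 i
    rw [h0, map_zero]
  have hh : h ∈ weightGE k (w i) (φ i - c i) := by
    refine mem_weightGE_of_mul_mem (hsc i) hs1 ?_
    have := sub_mem (hg i) (weightGE_anti (w i) (by omega) hgh)
    simpa using this
  have hinit : weightedHomogeneousComponent (w i) (φ i) g =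
      weightedHomogeneousComponent (w i) (c i) s *
        weightedHomogeneousComponent (w i) (φ i - c i) h := by
    rw [← weightedHomogeneousComponent_mul (hsc i) hh, add_sub_cancel, ← sub_eq_zero, ← map_sub]
    exact weightedHomogeneousComponent_eq_zero_of_mem hgh (by omega)
  set h₀ := weightedHomogeneousComponent (w i) (φ i - c i) h with hh₀
  set s₀ := weightedHomogeneousComponent (w i) (c i) s with hs₀
  -- Passing from `h` to `h₀` matters here: `s₀ * h₀` is a component of `g`, so it inherits all
  -- weight bounds of `g`, and `s₀` can be cancelled by `hs0`.
  have hh₀m : ∀ i', h₀ ∈ weightGE k (w i') (φ i' - c i') := by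
    intro i'
    refine mem_weightGE_of_mul_mem
      (weightedHomogeneousComponent_mem_weightGE (hsc i') (c i)) (hs0 i') ?_
    rw [← hs₀, ← hinit, add_sub_cancel]
    exact weightedHomogeneousComponent_mem_weightGE (hg i') _
  refine ⟨h₀, fun i' => ?_⟩
  by_cases hi : i' = i
  · subst hi
    have e : g - s * h₀ = (g - weightedHomogeneousComponent (w i') (φ i') g) -
        (s - s₀) * h₀ := by rw [hinit]; ring
    rw [e, Pi.single_eq_same]
    refine sub_mem (sub_weightedHomogeneousComponent_mem (hg i')) ?_
    have := mul_mem_weightGE (sub_weightedHomogeneousComponent_mem (hsc i')) (hh₀m i')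
    exact weightGE_anti _ (by omega) this
  · rw [Pi.single_eq_of_ne hi, add_zero]
    refine sub_mem (hg i') ?_
    have := mul_mem_weightGE (hsc i') (hh₀m i')
    rwa [add_sub_cancel] at this

theorem exists_mem_weightGE_of_forall [Fintype ι] {w : ι → σ → ℤ} {c : ι → ℤ}
    (hc : ∀ i j, c i ≤ w i j) (hpair : ∀ i i', ∃ j, w i j = c i ∧ w i' j = c i') {ψ : ι → ℤ}
    {f : MvPolynomial σ k} (hf : ∀ i, ∃ h, f - (∑ l, X l) * h ∈ weightGE k (w i) (ψ i)) :
    ∃ h, ∀ i, f - (∑ l, X l) * h ∈ weightGE k (w i) (ψ i) := by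
  classical
  have key : ∀ (n : ℕ) (φ : ι → ℤ), (∀ i, φ i ≤ ψ i) → ∑ i, (ψ i - φ i) = n →
      (∃ h, ∀ i, f - (∑ l, X l) * h ∈ weightGE k (w i) (φ i)) →
      ∃ h, ∀ i, f - (∑ l, X l) * h ∈ weightGE k (w i) (ψ i) := by
    intro n
    induction n with
    | zero =>
      intro φ hle hsum hφ
      have : ∀ i, ψ i - φ i = 0 := fun i =>
        (Finset.sum_eq_zero_iff_of_nonneg fun i _ => sub_nonneg.2 (hle i)).1
          (by simpa using hsum) i (Finset.mem_univ i)
      have e : φ = ψ := by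
        funext i
        have := this i
        omega
      rwa [e] at hφ
    | succ n ih =>
      rintro φ hle hsum ⟨h, hh⟩
      obtain ⟨i, hi⟩ : ∃ i, φ i < ψ i := by
        by_contra! hcon
        have : ∑ i, (ψ i - φ i) = 0 := Finset.sum_eq_zero fun i _ => by
          have := hcon i; have := hle i; omega
        omega
      obtain ⟨h₁, hh₁⟩ := hf i
      -- With `g = f - s * h`, the correction `h₁ - h` turns `g` into the lift `f - s * h₁` that is
      -- good for row `i`.
      obtain ⟨h₀, hh₀⟩ := exists_sub_sum_X_mul_mem_weightGE hc hpair (i := i) (h := h₁ - h) hh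
        (weightGE_anti (w i) (show φ i + 1 ≤ ψ i by omega) (by
          convert hh₁ using 1
          ring))
      refine ih (φ + Pi.single i 1) ?_ ?_ ⟨h + h₀, fun i' => ?_⟩
      · intro i'
        by_cases hi' : i' = i
        · subst hi'; simp; omega
        · simpa [Pi.single_eq_of_ne hi'] using hle i'
      · have : ∑ i', (ψ i' - (φ + Pi.single i 1 : ι → ℤ) i') = ∑ i', (ψ i' - φ i') - 1 := by
          simp [Finset.sum_sub_distrib, Finset.sum_add_distrib]
          ring
        rw [this, hsum]
        push_cast
        ring
      · rw [mul_add, ← sub_sub]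
        exact hh₀ i'
  -- As `f` has finitely many monomials, `ψ - N` is a bound that `f` itself meets, and the induction
  -- starts there with `h = 0`.
  obtain ⟨N, hN⟩ : ∃ N : ℕ, ∀ i, ∀ α ∈ f.support, ψ i - N ≤ Finsupp.weight (w i) α := by
    refine ⟨∑ i, ∑ α ∈ f.support, (ψ i - Finsupp.weight (w i) α).toNat, fun i α hα => ?_⟩
    have h1 := Finset.single_le_sum (f := fun i => ∑ α ∈ f.support,
      (ψ i - Finsupp.weight (w i) α).toNat) (fun _ _ => Nat.zero_le _) (Finset.mem_univ i)
    have h2 := Finset.single_le_sum (f := fun α =>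
      (ψ i - Finsupp.weight (w i) α).toNat) (fun _ _ => Nat.zero_le _) hα
    omega
  refine key (Fintype.card ι * N) (fun i => ψ i - N) (fun i => by simp) (by simp)
    ⟨0, fun i α hα => hN i α ?_⟩
  simpa using hα

end SumX

end MvPolynomial

/-! ### The degree one part of the symmetric algebra. -/

namespace SymmetricAlgebra

variable (k E : Type*) [Field k] [AddCommGroup E] [Module k E]

/-- The projection of the symmetric algebra to its part of degree one. -/
noncomputable def linearPart : SymmetricAlgebra k E →ₗ[k] E :=
  letI : Module kᵐᵒᵖ E := Module.compHom E ((RingHom.id k).fromOpposite mul_comm)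
  haveI : IsCentralScalar k E := ⟨fun _ _ => rfl⟩
  -- In the square-zero extension `k ⊕ E` products of two vectors vanish, so the second coordinate
  -- sees only degree one.
  (TrivSqZeroExt.sndHom k E).comp (lift (TrivSqZeroExt.inrHom k E)).toLinearMap

@[simp]
theorem linearPart_one : linearPart k E 1 = 0 :=
  letI : Module kᵐᵒᵖ E := Module.compHom E ((RingHom.id k).fromOpposite mul_comm)
  haveI : IsCentralScalar k E := ⟨fun _ _ => rfl⟩
  congrArg TrivSqZeroExt.snd (map_one (lift (TrivSqZeroExt.inrHom k E)))

@[simp]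
theorem linearPart_ι (e : E) : linearPart k E (ι k E e) = e := by
  simp [linearPart]

@[simp]
theorem linearPart_ι_mul_ι_mul (e e' : E) (x : SymmetricAlgebra k E) :
    linearPart k E (ι k E e * (ι k E e' * x)) = 0 := by
  simp [linearPart, ← mul_assoc, TrivSqZeroExt.inr_mul_inr]

theorem ι_injective : Function.Injective (ι k E) :=
  Function.LeftInverse.injective (linearPart_ι k E)

end SymmetricAlgebra

/-! ### Filtrations of the fibre and of its symmetric algebra. -/

theorem SmoothFan.isPLValue_ray {N ι : Type*} [AddCommGroup N] [Fintype ι] [DecidableEq ι]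
    (F : SmoothFan N ι) (ψ : ι → ℤ) (i : ι) : F.IsPLValue ψ (F.ray i) (ψ i) :=
  ⟨{i}, F.ray_mem i, fun _ => 1, by simp [SmoothFan.ray], by simp⟩

namespace ToricVectorBundle

variable {k N ι E : Type*} [Field k] [AddCommGroup N] [Fintype ι] [DecidableEq ι]
  [AddCommGroup E] [Module k E] {F : SmoothFan N ι} (V : ToricVectorBundle k F E)

theorem exists_adapted_at (ρ : F.support) :
    ∃ (r : ℕ) (e : Module.Basis (Fin r) k E) (m : Fin r → ℤ), ∀ f : E,
      V.val f ρ = (e.repr f).support.inf fun a => (m a : WithTop ℤ) := by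
  obtain ⟨σ, hσ, hρ⟩ := ρ.2
  obtain ⟨r, e, m, h⟩ := V.exists_adapted σ hσ
  exact ⟨r, e, fun a => m a ρ, fun f => h f ρ hρ⟩

/-- The step `{e | v(e)(ρ) ≥ r}` of the filtration of the fibre at `ρ`. -/
def valGE (ρ : F.support) (r : ℤ) : Submodule k E where
  carrier := {e | (r : WithTop ℤ) ≤ V.val e ρ}
  add_mem' := by
    intro x y hx hy
    obtain ⟨n, e, m, h⟩ := V.exists_adapted_at ρ
    simp only [Set.mem_ofPred_eq, h, Finset.le_inf_iff, Finsupp.mem_support_iff] at hx hy ⊢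
    intro a ha
    by_contra hlt
    apply ha
    rw [map_add, Finsupp.add_apply, not_not.1 (mt (hx a) hlt), not_not.1 (mt (hy a) hlt),
      add_zero]
  zero_mem' := by
    obtain ⟨n, e, m, h⟩ := V.exists_adapted_at ρ
    simp [h]
  smul_mem' := by
    intro c x hx
    obtain ⟨n, e, m, h⟩ := V.exists_adapted_at ρ
    simp only [Set.mem_ofPred_eq, h, Finset.le_inf_iff, Finsupp.mem_support_iff] at hx ⊢
    refine fun a ha => hx a fun h0 => ha ?_
    rw [map_smul, Finsupp.smul_apply, h0, smul_zero]

theorem mem_valGE {ρ : F.support} {r : ℤ} {e : E} :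
    e ∈ V.valGE ρ r ↔ (r : WithTop ℤ) ≤ V.val e ρ := Iff.rfl

theorem eq_zero_of_val_eq_top {ρ : F.support} {f : E} (hf : V.val f ρ = ⊤) : f = 0 := by
  obtain ⟨n, e, m, h⟩ := V.exists_adapted_at ρ
  rw [h, Finset.inf_eq_top_iff] at hf
  apply e.repr.injective
  rw [map_zero, ← Finsupp.support_eq_empty]
  exact Finset.eq_empty_of_forall_notMem fun a ha => WithTop.coe_ne_top (hf a ha)

theorem exists_valGE_eq_bot (ρ : F.support) : ∃ R : ℤ, ∀ r, R ≤ r → V.valGE ρ r = ⊥ := by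
  obtain ⟨n, e, m, h⟩ := V.exists_adapted_at ρ
  obtain ⟨R, hR⟩ := (Set.finite_range m).bddAbove
  refine ⟨R + 1, fun r hr => (Submodule.eq_bot_iff _).2 fun f hf => ?_⟩
  rw [mem_valGE, h, Finset.le_inf_iff] at hf
  apply e.repr.injective
  rw [map_zero, ← Finsupp.support_eq_empty]
  refine Finset.eq_empty_of_forall_notMem fun a ha => ?_
  have h1 := WithTop.coe_le_coe.1 (hf a ha)
  have h2 := hR ⟨a, rfl⟩
  omega

/-- The values of a vector at the rays bound its values on the cones: linear adapted bases make
the prevaluation concave on each cone. -/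
theorem le_val_of_isPLValue {e : E} {ψ : ι → ℤ} (h : ∀ i, e ∈ V.valGE (F.ray i) (ψ i))
    {ρ : F.support} {r : ℤ} (hr : F.IsPLValue ψ ρ r) : e ∈ V.valGE ρ r := by
  obtain ⟨σ, hσ, c, hc, rfl⟩ := hr
  obtain ⟨n, B, m, hm⟩ := V.exists_adapted σ hσ
  rw [mem_valGE, hm e ρ ⟨c, hc⟩, Finset.le_inf_iff]
  intro a ha
  rw [WithTop.coe_le_coe, hc, map_sum]
  refine Finset.sum_le_sum fun i hi => ?_
  rw [map_nsmul, nsmul_eq_mul]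
  refine mul_le_mul_of_nonneg_left ?_ (Int.natCast_nonneg _)
  have hi' := h i
  rw [mem_valGE, hm e (F.ray i) ⟨fun j => if j = i then 1 else 0, by simp [hi, SmoothFan.ray]⟩,
    Finset.le_inf_iff] at hi'
  exact WithTop.coe_le_coe.1 (hi' a ha)

theorem ι_mem_filt {ρ : F.support} {r : ℤ} {e : E} (h : e ∈ V.valGE ρ r) :
    SymmetricAlgebra.ι k E e ∈ V.filt ρ r :=
  Submodule.subset_span ⟨[e], by simpa using V.mem_valGE.1 h, by simp⟩

/-- Only products with exactly one factor have a nonzero linear part. Hence extending the filtration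
to `Sym E` does not enlarge it on `E`. -/
theorem linearPart_mem_valGE {ρ : F.support} {r : ℤ} {x : SymmetricAlgebra k E}
    (h : x ∈ V.filt ρ r) : SymmetricAlgebra.linearPart k E x ∈ V.valGE ρ r := by
  refine (Submodule.span_le (p := (V.valGE ρ r).comap (SymmetricAlgebra.linearPart k E))).2 ?_ h
  rintro _ ⟨l, hl, rfl⟩
  match l with
  | [] => simp
  | [e] => simpa [mem_valGE] using hl
  | e :: e' :: l => simp

theorem ι_mem_filt_iff {ρ : F.support} {r : ℤ} {e : E} :
    SymmetricAlgebra.ι k E e ∈ V.filt ρ r ↔ e ∈ V.valGE ρ r :=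
  ⟨fun h => by simpa using V.linearPart_mem_valGE h, V.ι_mem_filt⟩

theorem ι_mem_klyachko_iff {ψ : ι → ℤ} {e : E} :
    SymmetricAlgebra.ι k E e ∈ V.klyachko ψ ↔ ∀ i, e ∈ V.valGE (F.ray i) (ψ i) := by
  simp only [klyachko, Submodule.mem_iInf, ι_mem_filt_iff]
  exact ⟨fun h i => h _ _ (F.isPLValue_ray ψ i), fun h ρ r hr => V.le_val_of_isPLValue h hr⟩

theorem mem_filt_ray_of_mem_klyachko {ψ : ι → ℤ} {x : SymmetricAlgebra k E}
    (h : x ∈ V.klyachko ψ) (i : ι) : x ∈ V.filt (F.ray i) (ψ i) := by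
  simp only [klyachko, Submodule.mem_iInf] at h
  exact h _ _ (F.isPLValue_ray ψ i)

theorem one_mem_klyachko_of_nonpos {ψ : ι → ℤ} (hψ : ∀ i, ψ i ≤ 0) :
    (1 : SymmetricAlgebra k E) ∈ V.klyachko ψ := by
  simp only [klyachko, Submodule.mem_iInf]
  rintro ρ _ ⟨σ, hσ, c, hc, rfl⟩
  refine Submodule.subset_span ⟨[], ?_, by simp⟩
  rw [List.map_nil, List.sum_nil, ← WithTop.coe_zero, WithTop.coe_le_coe]
  exact Finset.sum_nonpos fun i _ => mul_nonpos_of_nonneg_of_nonpos (Int.natCast_nonneg _) (hψ i)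

/-! ### Lifting filtrations along a Khovanskii basis. -/

variable {κ : Type*} {b : κ → E}

/-- This is the linear part of the Khovanskii condition: the empty product and products of two or
more basis elements drop out. -/
theorem valGE_le_span_sup {ρ : F.support}
    (hB : IsKhovanskiiBasisFor (V.filt ρ) (Set.range fun j => SymmetricAlgebra.ι k E (b j)))
    (r : ℤ) : V.valGE ρ r ≤
      Submodule.span k (b '' {j | b j ∈ V.valGE ρ r}) ⊔ V.valGE ρ (r + 1) := by
  intro e he
  rw [← SymmetricAlgebra.linearPart_ι k E e]
  rw [← Submodule.mem_comap]
  refine SetLike.le_def.1 (sup_le (Submodule.span_le.2 ?_) ?_) (hB r (V.ι_mem_filt he))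
  · rintro _ ⟨l, hl, hsum, rfl⟩
    match l with
    | [] => simp
    | [x] =>
      obtain ⟨⟨j, hj⟩, hx⟩ := hl x (by simp)
      have hs : x.2 = r := by simpa using hsum
      rw [← hj, hs, ι_mem_filt_iff] at hx
      refine Submodule.mem_sup_left (Submodule.subset_span ⟨j, hx, ?_⟩)
      simp [← hj]
    | x :: y :: l =>
      obtain ⟨⟨j, hj⟩, -⟩ := hl x (by simp)
      obtain ⟨⟨j', hj'⟩, -⟩ := hl y (by simp)
      simp [← hj, ← hj']
  · exact fun x hx => Submodule.mem_sup_right (V.linearPart_mem_valGE hx)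

/-- A Khovanskii basis of vectors of the fibre spans each step of the filtrations of the fibre. -/
theorem valGE_le_span {ρ : F.support}
    (hB : IsKhovanskiiBasisFor (V.filt ρ) (Set.range fun j => SymmetricAlgebra.ι k E (b j)))
    (r : ℤ) : V.valGE ρ r ≤ Submodule.span k (b '' {j | b j ∈ V.valGE ρ r}) := by
  -- The filtration vanishes from `R` on, so the error term in `valGE_le_span_sup` is absorbed by
  -- descending induction on `r`.
  obtain ⟨R, hR⟩ := V.exists_valGE_eq_bot ρ
  have key : ∀ (n : ℕ) (r : ℤ), R - r ≤ n →
      V.valGE ρ r ≤ Submodule.span k (b '' {j | b j ∈ V.valGE ρ r}) := by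
    intro n
    induction n with
    | zero =>
      intro r hr
      rw [hR r (by simpa using hr)]
      exact bot_le
    | succ n ih =>
      intro r hr
      refine (V.valGE_le_span_sup hB r).trans (sup_le le_rfl ((ih (r + 1) ?_).trans ?_))
      · push_cast at hr
        omega
      · refine Submodule.span_mono (Set.image_mono fun j hj => ?_)
        exact (WithTop.coe_le_coe.2 (by omega)).trans (V.mem_valGE.1 hj)
  exact key (R - r).toNat r (Int.self_le_toNat _)

/-- The filtration of the symmetric algebra at `ρ` lifts to a weight filtration of the polynomial
ring on a Khovanskii basis of vectors. -/
theorem filt_le_map_weightGE {ρ : F.support}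
    (hB : IsKhovanskiiBasisFor (V.filt ρ) (Set.range fun j => SymmetricAlgebra.ι k E (b j)))
    {w : κ → ℤ} (hw : ∀ j, b j ≠ 0 → V.val (b j) ρ = w j) (r : ℤ) :
    V.filt ρ r ≤ (MvPolynomial.weightGE k w r).map
      (MvPolynomial.aeval (R := k) fun j => SymmetricAlgebra.ι k E (b j)).toLinearMap := by
  have h1 : ∀ (r : ℤ) (e : E), e ∈ V.valGE ρ r → SymmetricAlgebra.ι k E e ∈
      (MvPolynomial.weightGE k w r).map
        (MvPolynomial.aeval (R := k) fun j => SymmetricAlgebra.ι k E (b j)).toLinearMap := by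
    intro r e he
    rw [← Submodule.mem_comap]
    refine Submodule.span_le.2 ?_ (V.valGE_le_span hB r he)
    rintro _ ⟨j, hj, rfl⟩
    -- The weight of a zero vector is unconstrained, but such a vector contributes nothing to the
    -- span.
    by_cases h0 : b j = 0
    · rw [h0]
      exact zero_mem _
    · refine ⟨MvPolynomial.X j, MvPolynomial.X_mem_weightGE ?_, by simp⟩
      rw [Set.mem_ofPred_eq, mem_valGE, hw j h0] at hj
      exact WithTop.coe_le_coe.1 hj
  refine Submodule.span_le.2 ?_
  rintro _ ⟨l, hl, rfl⟩
  induction l generalizing r with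
  | nil =>
    refine ⟨1, MvPolynomial.one_mem_weightGE ?_, by simp⟩
    exact WithTop.coe_le_coe.1 (by simpa using hl)
  | cons e l ih =>
    by_cases htop : V.val e ρ = ⊤
    · simp only [V.eq_zero_of_val_eq_top htop, List.map_cons, map_zero, List.prod_cons, zero_mul]
      exact zero_mem _
    · obtain ⟨n, hn⟩ := WithTop.ne_top_iff_exists.1 htop
      rw [List.map_cons, List.sum_cons, ← hn] at hl
      obtain ⟨p, hp, hpe⟩ := h1 n e (V.mem_valGE.2 hn.le)
      obtain ⟨q, hq, hql⟩ := ih (r - n) (by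
        generalize (l.map fun e => V.val e ρ).sum = s at hl ⊢
        cases s with
        | top => exact le_top
        | coe s =>
          rw [← WithTop.coe_add, WithTop.coe_le_coe] at hl
          rw [WithTop.coe_le_coe]
          omega)
      refine ⟨p * q, ?_, ?_⟩
      · have := MvPolynomial.mul_mem_weightGE hp hq
        rwa [add_sub_cancel] at this
      · rw [List.map_cons, List.prod_cons, ← hpe, ← hql]
        simp

end ToricVectorBundle

/-- The right side does not depend on `j`: a multiple of the sum of the variables has all linear
coefficients equal. This is the source of both contradictions below. -/
theorem MvPolynomial.coeff_single_sum_X_mul {k κ : Type*} [Field k] [Fintype κ] (j : κ)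
    (h : MvPolynomial κ k) :
    coeff (Finsupp.single j 1) ((∑ l, X l) * h) = coeff 0 h := by
  classical
  rw [Finset.sum_mul, coeff_sum, Finset.sum_eq_single j]
  · simp [coeff_X_mul']
  · intro l _ hl
    simp [coeff_X_mul', hl]
  · simp

/-! ### Homogeneous elements of the section ring and their lifts. -/

namespace ToricVectorBundle

variable {k N ι E : Type*} [Field k] [AddCommGroup N] [Fintype ι] [DecidableEq ι]
  [AddCommGroup E] [Module k E] {F : SmoothFan N ι} (V : ToricVectorBundle k F E)

/-- The value of `b j` at the ray `i` as an integer, `0` if `b j = 0`. -/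
noncomputable def rayWeight {κ : Type*} (b : κ → E) (i : ι) (j : κ) : ℤ :=
  (V.val (b j) (F.ray i)).untopD 0

section

variable {κ : Type*} {b : κ → E}

theorem val_eq_rayWeight {j : κ} (h : b j ≠ 0) (i : ι) :
    V.val (b j) (F.ray i) = V.rayWeight b i j := by
  obtain ⟨n, hn⟩ := WithTop.ne_top_iff_exists.1 (mt V.eq_zero_of_val_eq_top h)
  rw [rayWeight, ← hn, WithTop.untopD_coe]

theorem mem_valGE_rayWeight (b : κ → E) (i : ι) (j : κ) :
    b j ∈ V.valGE (F.ray i) (V.rayWeight b i j) := by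
  by_cases h : b j = 0
  · rw [h]
    exact zero_mem _
  · exact (V.val_eq_rayWeight h i).ge

theorem single_mem_sectionRing_iff {ψ : ι → ℤ} {y : SymmetricAlgebra k E} :
    AddMonoidAlgebra.single ψ y ∈ V.sectionRing ↔ y ∈ V.klyachko ψ := by
  classical
  refine ⟨fun h => by simpa using h ψ, fun h φ => ?_⟩
  rw [AddMonoidAlgebra.coeff_single, Finsupp.single_apply]
  split_ifs with h'
  · exact h' ▸ h
  · exact zero_mem _

theorem coxVar_mem_sectionRing (i : ι) : coxVar k E i ∈ V.sectionRing := by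
  refine V.single_mem_sectionRing_iff.2 (V.one_mem_klyachko_of_nonpos fun i' => ?_)
  rw [Pi.neg_apply, neg_nonpos]
  by_cases h : i' = i
  · subst h; simp
  · simp [Pi.single_eq_of_ne h]

theorem single_mem_of_le {T : Subalgebra k (AddMonoidAlgebra (SymmetricAlgebra k E) (ι → ℤ))}
    (hT : ∀ i, coxVar k E i ∈ T) {ψ φ : ι → ℤ} (h : φ ≤ ψ) {y : SymmetricAlgebra k E}
    (hy : AddMonoidAlgebra.single ψ y ∈ T) : AddMonoidAlgebra.single φ y ∈ T := by
  -- The exponents `χ` with `t^(-χ)` in `T` form a monoid containing the unit vectors, hence also `ψ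
  -- - φ`.
  let A : AddSubmonoid (ι → ℤ) :=
    { carrier := {χ | AddMonoidAlgebra.single (-χ) (1 : SymmetricAlgebra k E) ∈ T}
      zero_mem' := by
        change AddMonoidAlgebra.single (-0) (1 : SymmetricAlgebra k E) ∈ T
        rw [neg_zero]
        exact one_mem T
      add_mem' := by
        intro χ χ' hχ hχ'
        have := mul_mem (S := Subalgebra k _) hχ hχ'
        rwa [AddMonoidAlgebra.single_mul_single, ← neg_add, mul_one] at this }
  have hA : ψ - φ ∈ A := by
    have e : ψ - φ = ∑ i, (ψ i - φ i).toNat • (Pi.single i 1 : ι → ℤ) := by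
      funext i
      have := h i
      rw [Finset.sum_apply, Finset.sum_eq_single i]
      · simp [this]
      · intro i' _ hi'
        simp [Pi.single_eq_of_ne hi'.symm]
      · simp
    rw [e]
    exact sum_mem fun i _ => nsmul_mem (show Pi.single i 1 ∈ A from hT i) _
  have := mul_mem (S := Subalgebra k _) hA hy
  rwa [AddMonoidAlgebra.single_mul_single, one_mul, neg_sub, sub_add_cancel] at this

/-- A monomial lies in `T` in the degree given by its own weights; the Cox variables lower that
degree to `ψ`. -/
theorem single_aeval_mem {T : Subalgebra k (AddMonoidAlgebra (SymmetricAlgebra k E) (ι → ℤ))}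
    (hT : ∀ i, coxVar k E i ∈ T) {w : ι → κ → ℤ}
    (hb : ∀ j, AddMonoidAlgebra.single (fun i => w i j) (SymmetricAlgebra.ι k E (b j)) ∈ T)
    {ψ : ι → ℤ} {g : MvPolynomial κ k} (hg : ∀ i, g ∈ MvPolynomial.weightGE k (w i) (ψ i)) :
    AddMonoidAlgebra.single ψ
      (MvPolynomial.aeval (fun j => SymmetricAlgebra.ι k E (b j)) g) ∈ T := by
  have hmon : ∀ α : κ →₀ ℕ, AddMonoidAlgebra.single (fun i => Finsupp.weight (w i) α)
      (MvPolynomial.aeval (R := k) (fun j => SymmetricAlgebra.ι k E (b j))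
        (MvPolynomial.monomial α 1)) ∈ T := by
    intro α
    induction α using Finsupp.induction_linear with
    | zero =>
      simp only [map_zero, MvPolynomial.monomial_zero', map_one]
      exact one_mem T
    | add α β hα hβ =>
      have := mul_mem hα hβ
      rw [AddMonoidAlgebra.single_mul_single, ← map_mul, MvPolynomial.monomial_mul,
        mul_one] at this
      simp only [map_add]
      exact this
    | single j n =>
      have := pow_mem (hb j) n
      rw [AddMonoidAlgebra.single_pow] at this
      convert this using 2
      · funext i
        simp [Finsupp.weight_single]
      · simp [MvPolynomial.aeval_monomial]
  rw [g.as_sum, map_sum, ← AddMonoidAlgebra.singleAddHom_apply, map_sum]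
  refine sum_mem fun α hα => ?_
  have h1 := single_mem_of_le hT (fun i => hg i α (MvPolynomial.mem_support_iff.1 hα)) (hmon α)
  have h2 := T.smul_mem h1 (MvPolynomial.coeff α g)
  rw [AddMonoidAlgebra.smul_single, ← map_smul, MvPolynomial.smul_monomial, smul_eq_mul,
    mul_one] at h2
  exact h2

/-- All homogeneous elements of the section ring lift to polynomials of bounded weight if the
vectors `b j` form a strong Khovanskii basis. -/
theorem exists_aeval_eq_of_mem_klyachko (hb : ∀ j, b j ≠ 0)
    (hS : V.IsStrongKhovanskiiBasis (Set.range fun j => SymmetricAlgebra.ι k E (b j)))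
    {ψ : ι → ℤ} {y : SymmetricAlgebra k E} (hy : y ∈ V.klyachko ψ) :
    ∃ q : MvPolynomial κ k, (∀ i, q ∈ MvPolynomial.weightGE k (V.rayWeight b i) (ψ i)) ∧
      MvPolynomial.aeval (R := k) (fun j => SymmetricAlgebra.ι k E (b j)) q = y := by
  classical
  obtain ⟨S, hhom, hadj, himg⟩ := hS
  -- `G ψ` consists of the elements with a lift good for all rays. Since `G ψ * G φ ⊆ G (ψ + φ)`, it
  -- suffices to check the generators.
  let G (ψ : ι → ℤ) : Submodule k (SymmetricAlgebra k E) :=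
    (⨅ i, MvPolynomial.weightGE k (V.rayWeight b i) (ψ i)).map
      (MvPolynomial.aeval (R := k) fun j => SymmetricAlgebra.ι k E (b j)).toLinearMap
  have hsingle : ∀ {ψ : ι → ℤ} {y}, y ∈ G ψ →
      ∀ φ, (AddMonoidAlgebra.single ψ y).coeff φ ∈ G φ := by
    intro ψ y hy φ
    rw [AddMonoidAlgebra.coeff_single, Finsupp.single_apply]
    split_ifs with h
    · exact h ▸ hy
    · exact zero_mem _
  have hone : ∀ {ψ : ι → ℤ}, (∀ i, ψ i ≤ 0) → 1 ∈ G ψ := fun {ψ} hψ =>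
    ⟨1, (Submodule.mem_iInf _).2 fun i => MvPolynomial.one_mem_weightGE (hψ i), by simp⟩
  have key : ∀ x ∈ Algebra.adjoin k (Set.range (coxVar k E (ι := ι)) ∪ S),
      ∀ ψ, x.coeff ψ ∈ G ψ := by
    intro x hx
    induction hx using Algebra.adjoin_induction with
    | mem x hx =>
      rcases hx with ⟨i, rfl⟩ | hx
      · refine hsingle (hone fun i' => ?_)
        rw [Pi.neg_apply, neg_nonpos]
        by_cases h : i' = i
        · subst h; simp
        · simp [Pi.single_eq_of_ne h]
      · obtain ⟨χ, a, rfl⟩ := hhom x hx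
        obtain ⟨j, hj⟩ : a ∈ Set.range fun j => SymmetricAlgebra.ι k E (b j) := by
          rw [← himg]
          exact ⟨_, hx, by simp [specialize]⟩
        -- The degree `χ` of a generator over `b j` is not prescribed, but membership in the section
        -- ring forces `χ i` to be at most the value of `b j` at each ray.
        have hmem := hadj.le (Algebra.subset_adjoin (Or.inr hx))
        rw [single_mem_sectionRing_iff, ← hj, ι_mem_klyachko_iff] at hmem
        refine hsingle ⟨MvPolynomial.X j, (Submodule.mem_iInf _).2 fun i =>
          MvPolynomial.X_mem_weightGE ?_, by simpa using hj⟩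
        have := V.mem_valGE.1 (hmem i)
        rw [V.val_eq_rayWeight (hb j)] at this
        exact WithTop.coe_le_coe.1 this
    | algebraMap r =>
      refine hsingle (ψ := 0) (y := algebraMap k _ r) ?_
      rw [Algebra.algebraMap_eq_smul_one]
      exact Submodule.smul_mem _ _ (hone fun _ => le_rfl)
    | add x y _ _ hx hy => exact fun ψ => add_mem (hx ψ) (hy ψ)
    | mul x y _ _ hx hy =>
      intro ψ
      rw [AddMonoidAlgebra.coeff_mul]
      refine sum_mem fun χ _ => sum_mem fun χ' _ => ?_
      dsimp only
      split_ifs with h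
      · obtain ⟨p, hp, hpx⟩ := hx χ
        obtain ⟨q, hq, hqy⟩ := hy χ'
        refine ⟨p * q, (Submodule.mem_iInf _).2 fun i => ?_, ?_⟩
        · rw [← h]
          exact MvPolynomial.mul_mem_weightGE ((Submodule.mem_iInf _).1 hp i)
            ((Submodule.mem_iInf _).1 hq i)
        · rw [← hpx, ← hqy]
          simp
      · exact zero_mem _
  have hx := key _ (hadj.ge (V.single_mem_sectionRing_iff.2 hy)) ψ
  rw [AddMonoidAlgebra.coeff_single, Finsupp.single_eq_same] at hx
  obtain ⟨q, hq, hqy⟩ := hx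
  exact ⟨q, (Submodule.mem_iInf _).1 hq, hqy⟩

end

/-! ### The two implications. -/

variable {κ : Type*} [Fintype κ] {b : κ → E}

theorem isStrongKhovanskiiBasis_of_forall_exists
    (hB : V.IsKhovanskiiBasis (Set.range fun j => SymmetricAlgebra.ι k E (b j)))
    (hrel : RingHom.ker (MvPolynomial.aeval (R := k) fun j => SymmetricAlgebra.ι k E (b j)) =
      Ideal.span {∑ j, (MvPolynomial.X j : MvPolynomial κ k)})
    (h : ∀ i i' : ι, ∃ j, (∀ l, V.rayWeight b i j ≤ V.rayWeight b i l) ∧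
      ∀ l, V.rayWeight b i' j ≤ V.rayWeight b i' l) :
    V.IsStrongKhovanskiiBasis (Set.range fun j => SymmetricAlgebra.ι k E (b j)) := by
  set w := V.rayWeight b with hw
  refine ⟨Set.range fun j => AddMonoidAlgebra.single (fun i => w i j)
    (SymmetricAlgebra.ι k E (b j)), ?_, le_antisymm ?_ ?_, ?_⟩
  · rintro _ ⟨j, rfl⟩
    exact ⟨_, _, rfl⟩
  · refine Algebra.adjoin_le (Set.union_subset ?_ ?_)
    · rintro _ ⟨i, rfl⟩
      exact V.coxVar_mem_sectionRing i
    · rintro _ ⟨j, rfl⟩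
      exact V.single_mem_sectionRing_iff.2
        (V.ι_mem_klyachko_iff.2 fun i => V.mem_valGE_rayWeight b i j)
  · intro x hx
    rw [← AddMonoidAlgebra.ofCoeff_coeff x, ← Finsupp.sum_single x.coeff, Finsupp.sum,
      AddMonoidAlgebra.ofCoeff_sum]
    refine sum_mem fun ψ _ => ?_
    change AddMonoidAlgebra.single ψ (x.coeff ψ) ∈ _
    have hy := hx ψ
    generalize x.coeff ψ = y at hy
    choose m hm hm' using h
    obtain ⟨f, rfl⟩ : ∃ f, MvPolynomial.aeval (R := k)
        (fun j => SymmetricAlgebra.ι k E (b j)) f = y := by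
      have := hB.1
      rw [Algebra.adjoin_range_eq_range_aeval] at this
      exact (AlgHom.range_eq_top _).1 this y
    -- The row minimum is read off at the column `m i i`; two lifts of the same element differ by a
    -- multiple of `s`, which supplies the hypothesis for each ray.
    obtain ⟨g, hg⟩ := MvPolynomial.exists_mem_weightGE_of_forall (w := w) (ψ := ψ) (f := f)
      (c := fun i => w i (m i i)) (fun i => hm i i)
      (fun i i' => ⟨m i i', le_antisymm (hm i i' _) (hm i i _),
        le_antisymm (hm' i i' _) (hm i' i' _)⟩) (by
        intro i
        obtain ⟨q, hq, hqf⟩ := V.filt_le_map_weightGE (hB.2 (F.ray i))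
          (fun j hj => V.val_eq_rayWeight hj i) (ψ i) (V.mem_filt_ray_of_mem_klyachko hy i)
        have hker : f - q ∈ RingHom.ker (MvPolynomial.aeval (R := k)
            fun j => SymmetricAlgebra.ι k E (b j)) := by
          rw [RingHom.mem_ker, map_sub, sub_eq_zero]
          exact hqf.symm
        rw [hrel, Ideal.mem_span_singleton] at hker
        obtain ⟨a, ha⟩ := hker
        refine ⟨a, ?_⟩
        rw [← ha, sub_sub_cancel]
        exact hq)
    have hs : MvPolynomial.aeval (R := k) (fun j => SymmetricAlgebra.ι k E (b j))
        (∑ j, (MvPolynomial.X j : MvPolynomial κ k)) = 0 := by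
      rw [← RingHom.mem_ker, hrel]
      exact Ideal.mem_span_singleton_self _
    have := single_aeval_mem (b := b)
      (T := Algebra.adjoin k (Set.range (coxVar k E (ι := ι)) ∪ Set.range fun j =>
        AddMonoidAlgebra.single (fun i => w i j) (SymmetricAlgebra.ι k E (b j))))
      (fun i => Algebra.subset_adjoin (Or.inl ⟨i, rfl⟩))
      (fun j => Algebra.subset_adjoin (Or.inr ⟨j, rfl⟩)) hg
    rwa [map_sub, map_mul, hs, zero_mul, sub_zero] at this
  · rw [← Set.range_comp]
    congr 1
    funext j
    simp [specialize]

theorem ne_zero_of_ker_aeval_eq [Nontrivial κ]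
    (hrel : RingHom.ker (MvPolynomial.aeval (R := k) fun j => SymmetricAlgebra.ι k E (b j)) =
      Ideal.span {∑ j, (MvPolynomial.X j : MvPolynomial κ k)}) (j : κ) : b j ≠ 0 := by
  classical
  intro h0
  obtain ⟨j', hj'⟩ := exists_ne j
  have hker : (MvPolynomial.X j : MvPolynomial κ k) ∈ RingHom.ker (MvPolynomial.aeval (R := k)
      fun j => SymmetricAlgebra.ι k E (b j)) := by
    rw [RingHom.mem_ker, MvPolynomial.aeval_X, h0, map_zero]
  rw [hrel, Ideal.mem_span_singleton] at hker
  obtain ⟨a, ha⟩ := hker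
  have h1 := congrArg (MvPolynomial.coeff (Finsupp.single j 1)) ha
  have h2 := congrArg (MvPolynomial.coeff (Finsupp.single j' 1)) ha
  rw [MvPolynomial.coeff_single_sum_X_mul] at h1 h2
  rw [← h1] at h2
  simp [MvPolynomial.coeff_X, Finsupp.single_left_inj, hj'.symm] at h2

theorem forall_exists_of_isStrongKhovanskiiBasis [Nonempty κ] (hb : ∀ j, b j ≠ 0)
    (hrel : RingHom.ker (MvPolynomial.aeval (R := k) fun j => SymmetricAlgebra.ι k E (b j)) =
      Ideal.span {∑ j, (MvPolynomial.X j : MvPolynomial κ k)})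
    (hS : V.IsStrongKhovanskiiBasis (Set.range fun j => SymmetricAlgebra.ι k E (b j)))
    (i i' : ι) : ∃ j, (∀ l, V.rayWeight b i j ≤ V.rayWeight b i l) ∧
      ∀ l, V.rayWeight b i' j ≤ V.rayWeight b i' l := by
  classical
  have hmin : ∀ i, ∃ m, ∀ l, V.rayWeight b i m ≤ V.rayWeight b i l :=
    fun i => Finite.exists_min (V.rayWeight b i)
  choose m hm using hmin
  by_contra! hcon
  have hne : ∀ j, V.rayWeight b i j = V.rayWeight b i (m i) → V.rayWeight b i' (m i') < V.rayWeight b i' j := by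
    intro j hj
    obtain ⟨l, hl⟩ := hcon j fun l => hj.le.trans (hm i l)
    exact (hm i' l).trans_lt hl
  have hii' : i ≠ i' := by
    rintro rfl
    exact lt_irrefl _ (hne (m i) rfl)
  have hsum : ∑ j, b j = 0 := by
    have : (∑ j, (MvPolynomial.X j : MvPolynomial κ k)) ∈ RingHom.ker
        (MvPolynomial.aeval (R := k) fun j => SymmetricAlgebra.ι k E (b j)) := by
      rw [hrel]
      exact Ideal.mem_span_singleton_self _
    rw [RingHom.mem_ker, map_sum] at this
    simp only [MvPolynomial.aeval_X, ← map_sum] at this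
    exact SymmetricAlgebra.ι_injective k E (this.trans (map_zero _).symm)
  let M : Finset κ := {j | V.rayWeight b i j = V.rayWeight b i (m i)}
  -- The row minima, raised by one at the two offending rays.
  let ψ : ι → ℤ := fun x => V.rayWeight b x (m x) + if x = i ∨ x = i' then 1 else 0
  have hf : SymmetricAlgebra.ι k E (∑ j ∈ M, b j) ∈ V.klyachko ψ := by
    refine V.ι_mem_klyachko_iff.2 fun x => ?_
    have hle : ∀ {j : κ} {r : ℤ}, r ≤ V.rayWeight b x j → b j ∈ V.valGE (F.ray x) r := fun {j r} h =>
      (WithTop.coe_le_coe.2 h).trans (V.mem_valGE.1 (V.mem_valGE_rayWeight b x j))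
    by_cases hx : x = i
    · subst hx
      -- At the ray `i` the relation trades the sum over `M` for minus the sum over its complement,
      -- whose values exceed the minimum.
      rw [← Finset.sum_add_sum_compl M, ← eq_neg_iff_add_eq_zero] at hsum
      rw [hsum]
      refine neg_mem (sum_mem fun j hj => hle ?_)
      have h1 : V.rayWeight b x j ≠ V.rayWeight b x (m x) := by simpa [M] using hj
      have h2 := hm x j
      simp only [ψ, true_or, if_true]
      omega
    · refine sum_mem fun j hj => hle ?_
      by_cases hx' : x = i'
      · subst hx'
        have := hne j (by simpa [M] using hj)
        simp only [ψ, or_true, if_true]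
        omega
      · simpa [ψ, hx, hx'] using hm x j
  obtain ⟨q, hq, hqf⟩ := V.exists_aeval_eq_of_mem_klyachko hb hS hf
  have hker : q - ∑ j ∈ M, MvPolynomial.X j ∈ RingHom.ker (MvPolynomial.aeval (R := k)
      fun j => SymmetricAlgebra.ι k E (b j)) := by
    rw [RingHom.mem_ker, map_sub, hqf]
    simp
  rw [hrel, Ideal.mem_span_singleton] at hker
  obtain ⟨a, ha⟩ := hker
  have hcoeff : ∀ j, MvPolynomial.coeff 0 a =
      MvPolynomial.coeff (Finsupp.single j 1) q - if j ∈ M then 1 else 0 := by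
    intro j
    rw [← MvPolynomial.coeff_single_sum_X_mul j, ← ha, MvPolynomial.coeff_sub,
      MvPolynomial.coeff_sum]
    simp [MvPolynomial.coeff_X, Finsupp.single_left_inj]
  -- The variable of the column `m x` has weight `ψ x - 1`, too small to occur in `q`.
  have hzero : ∀ x, (x = i ∨ x = i') → MvPolynomial.coeff (Finsupp.single (m x) 1) q = 0 := by
    intro x hx
    by_contra h
    have := hq x _ h
    rw [Finsupp.weight_single, one_smul] at this
    simp only [ψ, if_pos hx] at this
    omega
  have h1 := hcoeff (m i)
  have h2 := hcoeff (m i')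
  rw [hzero i (Or.inl rfl), if_pos (by simp [M])] at h1
  rw [hzero i' (Or.inr rfl), if_neg (fun h => lt_irrefl _ (hne _ (by simpa [M] using h))), h1] at h2
  simp at h2

end ToricVectorBundle

theorem mainTheorem9 {k : Type*} [Field k] [IsAlgClosed k]
    {N : Type*} [AddCommGroup N] [Module.Free ℤ N] [Module.Finite ℤ N]
    {ι : Type*} [Fintype ι] [DecidableEq ι] (F : SmoothFan N ι)
    {E : Type*} [AddCommGroup E] [Module k E] [FiniteDimensional k E]
    (V : ToricVectorBundle k F E)
    {d : ℕ} (hd : 0 < d) (b : Fin d → E)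
    (hB : V.IsKhovanskiiBasis (Set.range fun j => SymmetricAlgebra.ι k E (b j)))
    (hrel : RingHom.ker (MvPolynomial.aeval (R := k) fun j => SymmetricAlgebra.ι k E (b j)) =
      Ideal.span {∑ j : Fin d, (MvPolynomial.X j : MvPolynomial (Fin d) k)})
    (hrows : ∀ i, V.diagram b i ∈
      tropicalHypersurface (∑ j : Fin d, (MvPolynomial.X j : MvPolynomial (Fin d) k))) :
    V.IsStrongKhovanskiiBasis (Set.range fun j => SymmetricAlgebra.ι k E (b j)) ↔
      ∀ i i' : ι, ∃ j : Fin d, (∀ l, V.diagram b i j ≤ V.diagram b i l) ∧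
        ∀ l, V.diagram b i' j ≤ V.diagram b i' l := by
  have : Nonempty (Fin d) := ⟨⟨0, hd⟩⟩
  -- For `d = 1` the relation kills the only basis vector, so the diagram has infinite entries and
  -- integer weights do not describe it; both sides then hold trivially. For `d ≥ 2` all `b j` are
  -- nonzero.
  rcases subsingleton_or_nontrivial (Fin d) with hsub | hnt
  · refine iff_of_true (V.isStrongKhovanskiiBasis_of_forall_exists hB hrel fun i i' => ?_)
      fun i i' => ?_
    · exact ⟨⟨0, hd⟩, fun l => by rw [Subsingleton.elim l ⟨0, hd⟩],
        fun l => by rw [Subsingleton.elim l ⟨0, hd⟩]⟩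
    · exact ⟨⟨0, hd⟩, fun l => by rw [Subsingleton.elim l ⟨0, hd⟩],
        fun l => by rw [Subsingleton.elim l ⟨0, hd⟩]⟩
  · have hb := ToricVectorBundle.ne_zero_of_ker_aeval_eq hrel
    have hD : ∀ i j, V.diagram b i j = V.rayWeight b i j := fun i j => V.val_eq_rayWeight (hb j) i
    simp only [hD, WithTop.coe_le_coe]
    exact ⟨V.forall_exists_of_isStrongKhovanskiiBasis hb hrel,
      V.isStrongKhovanskiiBasis_of_forall_exists hB hrel⟩
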